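/- Let $M$ be an $n$-dimensional smooth manifold with a smooth torsion-free affine connection $\nabla$ such that for every $x\in M$ the exponential map $\exp_x$ is defined on all of $T_xM$ and maps onto $M$. A set $C\subseteq M$ is convex if every geodesic $\gamma:[a,b]\to M$ with $\gamma(a),\gamma(b)\in C$ stays in $C$; a function on $C$ is convex if it is convex along every geodesic in $C$. For a smooth function $f$ write $Hf(X,Y)=(\nabla_X Df)(Y)=X(Df(Y))-Df(\nabla_XY)$ for its Hessian and $\|u\|_{f,x}=\sqrt{Hf_x(u,u)}$. Let $C\subseteq M$ be an open convex set and let $\sigma\ge 0$. Let $f:C\to\mathbb R$ be weakly $\sigma$-self-concordant ($\sigma$-WSC), that is: $f$ is smooth and convex, its epigraph $\{(x,y)\in C\times\mathbb R : y\ge f(x)\}$ is closed in $M\times\mathbb R$, $Hf_x$ is positive definite for all $x\in C$, and $$|(\nabla_uHf)(u,u)|\le 2\sigma\,Hf(u,u)^{3/2}\qquad(x\in C,\ u\in T_xM).$$ For $x\in C$ and $r\in[0,\infty]$ let $$W^0(x;r)=\{\gamma(1) : \gamma:[0,1]\to M \text{ a geodesic},\ \gamma(0)=x,\ \|\dot\gamma(0)\|_{f,x}<r\}.$$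 Put $\omega(t)=t-\log(1+t)$ and $\omega_*(t)=-t-\log(1-t)$. In the case $\sigma=0$ read $1/\sigma$ as $\infty$, and read both $\frac1{\sigma^2}\omega(\sigma r)$ and $\frac1{\sigma^2}\omega_*(\sigma r)$ as their common limit $r^2/2$. (1) For every $x\in C$, $W^0(x;1/\sigma)\subseteq C$. (2) Let $\gamma:[0,1]\to C$ be a geodesic, and put $r_0=\|\dot\gamma(0)\|_{f,\gamma(0)}$ and $r_1=\|\dot\gamma(1)\|_{f,\gamma(1)}$. Then $$r_1\ge\frac{r_0}{1+\sigma r_0},\qquad Df_{\gamma(1)}(\dot\gamma(1))-Df_{\gamma(0)}(\dot\gamma(0))\ge\frac{r_0^2}{1+\sigma r_0},$$ $$f(\gamma(1))\ge f(\gamma(0))+Df_{\gamma(0)}(\dot\gamma(0))+\frac1{\sigma^2}\,\omega(\sigma r_0).$$ If in addition $r_0<1/\sigma$, then $$r_1\le\frac{r_0}{1-\sigma r_0},\qquad Df_{\gamma(1)}(\dot\gamma(1))-Df_{\gamma(0)}(\dot\gamma(0))\le\frac{r_0^2}{1-\sigma r_0},$$ $$f(\gamma(1))\le f(\gamma(0))+Df_{\gamma(0)}(\dot\gamma(0))+\frac1{\sigma^2}\,\omega_*(\sigma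 r_0).$$ -/

import Mathlib

open Set Bundle
open scoped Manifold ContDiff Topology ENNReal

noncomputable section

namespace AffineManifold

variable {E : Type*} [NormedAddCommGroup E] [NormedSpace ℝ E]
  {M : Type*} [TopologicalSpace M] [ChartedSpace E M] [IsManifold 𝓘(ℝ, E) ∞ M]

/-- An affine connection `∇` on `M`, as a covariant derivative on the tangent bundle.
The argument order is `cov Y x u = ∇_u Y` for `u ∈ T_x M` and a vector field `Y`. -/
abbrev Connection (E : Type*) [NormedAddCommGroup E] [NormedSpace ℝ E]
    (M : Type*) [TopologicalSpace M] [ChartedSpace E M] [IsManifold 𝓘(ℝ, E) ∞ M] :=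
  CovariantDerivative 𝓘(ℝ, E) E (TangentSpace 𝓘(ℝ, E) : M → Type _)

/-! ### Curves, parallel fields and geodesics -/

/-- The velocity `γ̇(t)` of a curve `γ : s → M`; one-sided at the endpoints of an interval `s`. -/
def velocity (γ : ℝ → M) (s : Set ℝ) (t : ℝ) : TangentSpace 𝓘(ℝ, E) (γ t) :=
  mfderivWithin 𝓘(ℝ, ℝ) 𝓘(ℝ, E) γ s t (1 : ℝ)

/-- The covariant derivative `(∇_γ̇ V)(t)` of a vector field `V` along the curve `γ : s → M`.
Write `V = ∑ᵢ vⁱ eᵢ` in the coordinate frame `(eᵢ)` of the chart at `γ t`; the value is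
`∑ᵢ v̇ⁱ(t) eᵢ + ∇_{γ̇(t)} (∑ᵢ vⁱ(t) eᵢ)`. The first summand is the derivative of the coordinate
vector of `V`, transported back to the tangent space at `γ t`; in the second, the field
`∑ᵢ vⁱ(t) eᵢ` with constant coordinates is `FiberBundle.extend E (V t)`. -/
def covDerivAlong (cov : Connection E M) (γ : ℝ → M) (s : Set ℝ)
    (V : ∀ t, TangentSpace 𝓘(ℝ, E) (γ t)) (t : ℝ) : TangentSpace 𝓘(ℝ, E) (γ t) :=
  (trivializationAt E (TangentSpace 𝓘(ℝ, E) : M → Type _) (γ t)).symm (γ t)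
      (derivWithin (fun τ ↦ ((trivializationAt E (TangentSpace 𝓘(ℝ, E) : M → Type _) (γ t))
        (⟨γ τ, V τ⟩ : TangentBundle 𝓘(ℝ, E) M)).2) s t)
    + cov (FiberBundle.extend E (V t)) (γ t) (velocity γ s t)

/-- `γ : s → M` is a geodesic: a smooth curve whose velocity is parallel along `γ`. -/
structure IsGeodesicOn (cov : Connection E M) (γ : ℝ → M) (s : Set ℝ) : Prop where
  smooth : ContMDiffOn 𝓘(ℝ, ℝ) 𝓘(ℝ, E) ∞ γ s
  parallel : ∀ t ∈ s, covDerivAlong cov γ s (velocity γ s) t = 0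

/-- For each `x`, the exponential map `exp_x : u ↦ γ(1)`, where `γ` is the geodesic with
`γ(0) = x` and `γ̇(0) = u`, is defined on all of `T_x M` and is onto `M`. -/
structure ExpDefinedSurjective (cov : Connection E M) : Prop where
  defined : ∀ (x : M) (u : TangentSpace 𝓘(ℝ, E) x), ∃ γ : ℝ → M,
    IsGeodesicOn cov γ (Icc 0 1) ∧
      (⟨γ 0, velocity γ (Icc 0 1) 0⟩ : TangentBundle 𝓘(ℝ, E) M) = ⟨x, u⟩
  surjective : ∀ x y : M, ∃ γ : ℝ → M, IsGeodesicOn cov γ (Icc 0 1) ∧ γ 0 = x ∧ γ 1 = y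

/-! ### Covariant derivatives of tensors, Hessian -/

/-- The Hessian `Hf_x(u, v) = (∇_u Df)(v) = u(Df(Y)) - Df_x(∇_u Y)`, where `Y` is a vector field
with `Y_x = v`; the value does not depend on `Y`, and `Y` is taken to have constant coordinates in
the chart at `x`. -/
def hessian (cov : Connection E M) (f : M → ℝ) (x : M) (u v : TangentSpace 𝓘(ℝ, E) x) : ℝ :=
  mvfderiv 𝓘(ℝ, E) (fun y ↦ mvfderiv 𝓘(ℝ, E) f y (FiberBundle.extend E v y)) x u
    - mvfderiv 𝓘(ℝ, E) f x (cov (FiberBundle.extend E v) x u)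

/-- The covariant derivative of a `(0,2)`-tensor field `G`:
`(∇_u G)(v, w) = u(G(Y, Z)) - G(∇_u Y, w) - G(v, ∇_u Z)`, where `Y`, `Z` are vector fields with
`Y_x = v`, `Z_x = w`, taken to have constant coordinates in the chart at `x`. -/
def covDerivTensor (cov : Connection E M)
    (G : ∀ x : M, TangentSpace 𝓘(ℝ, E) x → TangentSpace 𝓘(ℝ, E) x → ℝ)
    (x : M) (u v w : TangentSpace 𝓘(ℝ, E) x) : ℝ :=
  mvfderiv 𝓘(ℝ, E) (fun y ↦ G y (FiberBundle.extend E v y) (FiberBundle.extend E w y)) x u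
    - G x (cov (FiberBundle.extend E v) x u) w
    - G x v (cov (FiberBundle.extend E w) x u)

/-! ### Convexity -/

/-- Geodesic convexity of a set: every geodesic with endpoints in `C` stays in `C`. -/
def GeodesicallyConvex (cov : Connection E M) (C : Set M) : Prop :=
  ∀ (a b : ℝ) (γ : ℝ → M), a ≤ b → IsGeodesicOn cov γ (Icc a b) → γ a ∈ C → γ b ∈ C →
    ∀ t ∈ Icc a b, γ t ∈ C

/-- Geodesic convexity of a function `f : C → ℝ`: it is convex along every geodesic in `C`. -/
def GeodesicallyConvexFunOn (cov : Connection E M) (C : Set M) (f : M → ℝ) : Prop :=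
  ∀ (a b : ℝ) (γ : ℝ → M), a ≤ b → IsGeodesicOn cov γ (Icc a b) → MapsTo γ (Icc a b) C →
    ConvexOn ℝ (Icc a b) (f ∘ γ)

/-! ### Weak self-concordance -/

/-- A smooth, closed, nondegenerate convex function `f : C → ℝ` on an open set `C` is weakly
`σ`-self-concordant. Only the values of `f` on `C` matter. -/
structure IsWeaklySelfConcordant (cov : Connection E M) (C : Set M) (f : M → ℝ) (σ : ℝ) :
    Prop where
  nonneg : 0 ≤ σ
  smooth : ContMDiffOn 𝓘(ℝ, E) 𝓘(ℝ, ℝ) ∞ f C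
  convex : GeodesicallyConvexFunOn cov C f
  /-- `f` is closed: its epigraph is a closed subset of `M × ℝ`. -/
  closed : IsClosed {p : M × ℝ | p.1 ∈ C ∧ f p.1 ≤ p.2}
  /-- `f` is nondegenerate: its Hessian is positive definite on `C`. -/
  nondegenerate : ∀ x ∈ C, ∀ u : TangentSpace 𝓘(ℝ, E) x, u ≠ 0 → 0 < hessian cov f x u u
  bound : ∀ x ∈ C, ∀ u : TangentSpace 𝓘(ℝ, E) x,
    |covDerivTensor cov (hessian cov f) x u u u| ≤ 2 * σ * (hessian cov f x u u) ^ (3 / 2 : ℝ)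

/-- The local norm `‖u‖_{f,x} = √(Hf_x(u, u))`. -/
def localNorm (cov : Connection E M) (f : M → ℝ) (x : M) (u : TangentSpace 𝓘(ℝ, E) x) : ℝ :=
  √(hessian cov f x u u)

/-- The Dikin ellipsoid `W⁰(x; r)`: the image under `exp_x` of the open `‖·‖_{f,x}`-ball of radius
`r ∈ [0, ∞]` in `T_x M`. The geodesics run in `M`; they are not required to stay in the domain
of `f`. -/
def dikinEllipsoid (cov : Connection E M) (f : M → ℝ) (x : M) (r : ℝ≥0∞) : Set M :=
  {y | ∃ γ : ℝ → M, IsGeodesicOn cov γ (Icc 0 1) ∧ γ 0 = x ∧ γ 1 = y ∧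
    ENNReal.ofReal (localNorm cov f (γ 0) (velocity γ (Icc 0 1) 0)) < r}

/-- `ω(t) = t - log(1 + t)`. -/
def omega (t : ℝ) : ℝ := t - Real.log (1 + t)

/-- `ω*(t) = -t - log(1 - t)`. -/
def omegaStar (t : ℝ) : ℝ := -t - Real.log (1 - t)

end AffineManifold

end

namespace AffineManifold

/-! Everything happens along one geodesic `γ`. Put `φ(t) = f(γ(t))`. Since the velocity is parallel,
`φ' = Df(γ̇)`, `φ'' = Hf(γ̇, γ̇) =: q` and `q' = (∇_γ̇ Hf)(γ̇, γ̇)`. Self-concordance becomes `|q'|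
≤ 2σ q^{3/2}`, which says that `q^{-1/2}` is `σ`-Lipschitz. Hence `√q(t)` lies between `r/(1 + σtr)`
and `r/(1 - σtr)` with `r = √q(0)` (`sqrt_le_and_sqrt_mul_le`), and integrating the squares twice
produces the bounds on `φ'` and `φ` (`lower_bounds`, `upper_bounds`).

For the Dikin ellipsoid, suppose a geodesic with `σr < 1` leaves `C`, first at time `T`. The upper
bounds hold on `[0, T)` and keep `f ∘ γ` bounded there, so closedness of the epigraph forces `γ(T) ∈
C`, a contradiction (`mapsTo_of_localNorm_lt`).

The geometric content is the formula for `φ''` and `q'`. The velocity need not extend to a vector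
field, so it is expanded in a chart frame; the product rule and the geodesic equation then give
`hasDerivWithinAt_oneForm` and `hasDerivWithinAt_tensor`. These need `Hf` to be bilinear and
differentiable in the frame, which follows from tensoriality. -/

/-! ### One-variable differential inequalities -/

/-- If `F' ≤ G'` on `[0, T]`, then `F` grows at most as much as `G`. -/
theorem sub_le_sub_of_hasDerivWithinAt_le {F G F' G' : ℝ → ℝ} {T : ℝ}
    (hF : ∀ t ∈ Icc 0 T, HasDerivWithinAt F (F' t) (Icc 0 T) t)
    (hG : ∀ t ∈ Icc 0 T, HasDerivWithinAt G (G' t) (Icc 0 T) t)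
    (hle : ∀ t ∈ Icc 0 T, F' t ≤ G' t) {t : ℝ} (ht : t ∈ Icc 0 T) :
    F t - F 0 ≤ G t - G 0 := by
  have hmono : MonotoneOn (fun t ↦ G t - F t) (Icc 0 T) := by
    have hd : ∀ t ∈ Icc 0 T,
        HasDerivWithinAt (fun t ↦ G t - F t) (G' t - F' t) (Icc 0 T) t :=
      fun t ht ↦ (hG t ht).sub (hF t ht)
    refine monotoneOn_of_hasDerivWithinAt_nonneg (f' := fun t ↦ G' t - F' t) (convex_Icc 0 T)
      (fun t ht ↦ (hd t ht).continuousWithinAt)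
      (fun t ht ↦ (hd t (interior_subset ht)).mono interior_subset)
      (fun t ht ↦ sub_nonneg.2 (hle t (interior_subset ht)))
  have := hmono ⟨le_rfl, ht.1.trans ht.2⟩ ht ht.1
  dsimp only at this
  linarith

/-- If `|q'| ≤ 2σ q^{3/2}`, then `(q + ε)^{-1/2}` is `σ`-Lipschitz for every `ε > 0`. -/
theorem abs_inv_sqrt_add_sub_le {q q' : ℝ → ℝ} {σ T : ℝ} (hσ : 0 ≤ σ)
    (hq : ∀ t ∈ Icc 0 T, HasDerivWithinAt q (q' t) (Icc 0 T) t)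
    (hq0 : ∀ t ∈ Icc 0 T, 0 ≤ q t)
    (hbound : ∀ t ∈ Icc 0 T, |q' t| ≤ 2 * σ * q t ^ (3 / 2 : ℝ))
    {ε : ℝ} (hε : 0 < ε) {t : ℝ} (ht : t ∈ Icc 0 T) :
    |(√(q t + ε))⁻¹ - (√(q 0 + ε))⁻¹| ≤ σ * t := by
  have hd : ∀ t ∈ Icc 0 T, HasDerivWithinAt (fun t ↦ (√(q t + ε))⁻¹)
      (-(q' t / (2 * √(q t + ε))) / √(q t + ε) ^ 2) (Icc 0 T) t := by
    intro t ht
    have hp : 0 < q t + ε := by linarith [hq0 t ht]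
    exact (((hq t ht).add_const ε).sqrt hp.ne').fun_inv (Real.sqrt_pos.2 hp).ne'
  have h := Convex.norm_image_sub_le_of_norm_hasDerivWithin_le hd (C := σ) ?_ (convex_Icc 0 T)
    (⟨le_rfl, ht.1.trans ht.2⟩ : (0 : ℝ) ∈ Icc 0 T) ht
  · rwa [Real.norm_eq_abs, sub_zero, Real.norm_eq_abs, abs_of_nonneg ht.1] at h
  intro t ht
  have hp : 0 < q t + ε := by linarith [hq0 t ht]
  set w := √(q t + ε) with hw
  have hw0 : 0 < w := Real.sqrt_pos.2 hp
  -- The derivative is `-q' / (2 w³)`, so it is enough to replace `q^{3/2}` by `w³`.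
  have h1 : q t ^ (3 / 2 : ℝ) ≤ w ^ 3 := by
    calc q t ^ (3 / 2 : ℝ) ≤ (q t + ε) ^ (3 / 2 : ℝ) :=
          Real.rpow_le_rpow (hq0 t ht) (by linarith) (by norm_num)
      _ = w ^ 3 := by
          rw [hw, Real.sqrt_eq_rpow, ← Real.rpow_natCast, ← Real.rpow_mul hp.le]
          norm_num
  have h2 : |q' t| ≤ 2 * σ * w ^ 3 :=
    (hbound t ht).trans (mul_le_mul_of_nonneg_left h1 (by positivity))
  rw [Real.norm_eq_abs, abs_div, abs_neg, abs_div, abs_of_pos (by positivity : 0 < w ^ 2),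
    abs_of_pos (by positivity : 0 < 2 * w), div_div, div_le_iff₀ (by positivity)]
  linarith [h2]

/-- Limit `ε → 0` of the Lipschitz estimate. Denominators are cleared first, so that the
inequalities survive where `q` vanishes, as on constant geodesics. -/
theorem sqrt_le_and_sqrt_mul_le {q q' : ℝ → ℝ} {σ T : ℝ} (hσ : 0 ≤ σ)
    (hq : ∀ t ∈ Icc 0 T, HasDerivWithinAt q (q' t) (Icc 0 T) t)
    (hq0 : ∀ t ∈ Icc 0 T, 0 ≤ q t)
    (hbound : ∀ t ∈ Icc 0 T, |q' t| ≤ 2 * σ * q t ^ (3 / 2 : ℝ))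
    {t : ℝ} (ht : t ∈ Icc 0 T) :
    √(q 0) ≤ √(q t) * (1 + σ * t * √(q 0)) ∧ √(q t) * (1 - σ * t * √(q 0)) ≤ √(q 0) := by
  have h0 : (0 : ℝ) ∈ Icc 0 T := ⟨le_rfl, ht.1.trans ht.2⟩
  have hlim : ∀ a : ℝ, Filter.Tendsto (fun ε ↦ √(a + ε)) (𝓝[>] 0) (𝓝 (√a)) := by
    intro a
    have : Continuous fun ε : ℝ ↦ √(a + ε) := by fun_prop
    simpa using (this.tendsto 0).mono_left nhdsWithin_le_nhds
  have key : ∀ ε > 0, √(q 0 + ε) ≤ √(q t + ε) * (1 + σ * t * √(q 0 + ε)) ∧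
      √(q t + ε) * (1 - σ * t * √(q 0 + ε)) ≤ √(q 0 + ε) := by
    intro ε hε
    have h := abs_le.1 (abs_inv_sqrt_add_sub_le hσ hq hq0 hbound hε ht)
    have ha : 0 < √(q 0 + ε) := Real.sqrt_pos.2 (by linarith [hq0 0 h0])
    have hb : 0 < √(q t + ε) := Real.sqrt_pos.2 (by linarith [hq0 t ht])
    generalize √(q 0 + ε) = a at *
    generalize √(q t + ε) = b at *
    have hab : 0 < a * b := mul_pos ha hb
    have e : a * b * (b⁻¹ - a⁻¹) = a - b := by field_simp
    have h1 := mul_le_mul_of_nonneg_left h.1 hab.le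
    have h2 := mul_le_mul_of_nonneg_left h.2 hab.le
    rw [e] at h1 h2
    constructor <;> linarith
  constructor
  · exact le_of_tendsto_of_tendsto (hlim _)
      ((hlim _).mul (((hlim _).const_mul (σ * t)).const_add 1))
      (Filter.eventually_of_mem self_mem_nhdsWithin fun ε hε ↦ (key ε hε).1)
  · exact le_of_tendsto_of_tendsto
      ((hlim _).mul (((hlim _).const_mul (σ * t)).const_sub 1)) (hlim _)
      (Filter.eventually_of_mem self_mem_nhdsWithin fun ε hε ↦ (key ε hε).2)

/-- The solution `r² t / (1 + c r t)` of `y' = r² / (1 + c r t)²`, `y(0) = 0`. -/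
theorem hasDerivAt_mul_div_one_add (c r : ℝ) {t : ℝ} (ht : 1 + c * t * r ≠ 0) :
    HasDerivAt (fun t ↦ r ^ 2 * t / (1 + c * t * r)) ((r / (1 + c * t * r)) ^ 2) t := by
  have h1 : HasDerivAt (fun t ↦ r ^ 2 * t) (r ^ 2) t := by
    simpa using (hasDerivAt_id t).const_mul (r ^ 2)
  have h2 : HasDerivAt (fun t ↦ 1 + c * t * r) (c * r) t := by
    simpa using (((hasDerivAt_id t).const_mul c).mul_const r).const_add 1
  refine (h1.fun_div h2 ht).congr_deriv ?_
  field_simp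
  ring

theorem hasDerivAt_omega_mul {c r : ℝ} (hc : c ≠ 0) {t : ℝ} (ht : 1 + c * t * r ≠ 0) :
    HasDerivAt (fun t ↦ 1 / c ^ 2 * omega (c * t * r)) (r ^ 2 * t / (1 + c * t * r)) t := by
  have h2 : HasDerivAt (fun t ↦ c * t * r) (c * r) t := by
    simpa using ((hasDerivAt_id t).const_mul c).mul_const r
  refine ((h2.fun_sub ((h2.const_add 1).log ht)).const_mul (1 / c ^ 2)).congr_deriv ?_
  rw [eq_div_iff ht, mul_assoc, sub_mul, div_mul_cancel₀ _ ht]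
  field_simp
  ring

/-- A quantity that vanishes at `0` and has derivative `r² t / (1 + c r t)`. -/
theorem hasDerivAt_primitive (c r : ℝ) {t : ℝ} (ht : 1 + c * t * r ≠ 0) :
    HasDerivAt (fun t ↦ if c = 0 then r ^ 2 * t ^ 2 / 2 else 1 / c ^ 2 * omega (c * t * r))
      (r ^ 2 * t / (1 + c * t * r)) t := by
  split_ifs with hc
  · have h := ((hasDerivAt_pow 2 t).const_mul (r ^ 2)).div_const 2
    refine h.congr_deriv ?_
    simp only [hc, zero_mul, add_zero, div_one, Nat.cast_ofNat]
    ring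
  · exact hasDerivAt_omega_mul hc ht

/-- Two integrations of the comparison function. The sign of `c` is free: `c = σ` serves the lower
bounds here, `c = -σ` the upper bounds in `upper_bounds`. -/
theorem lower_bounds {φ φ' q : ℝ → ℝ} {c r T : ℝ}
    (hφ : ∀ t ∈ Icc 0 T, HasDerivWithinAt φ (φ' t) (Icc 0 T) t)
    (hφ' : ∀ t ∈ Icc 0 T, HasDerivWithinAt φ' (q t) (Icc 0 T) t)
    (hc : ∀ t ∈ Icc 0 T, 0 < 1 + c * t * r)
    (hq : ∀ t ∈ Icc 0 T, (r / (1 + c * t * r)) ^ 2 ≤ q t) {t : ℝ} (ht : t ∈ Icc 0 T) :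
    r ^ 2 * t / (1 + c * t * r) ≤ φ' t - φ' 0 ∧
    φ 0 + φ' 0 * t + (if c = 0 then r ^ 2 * t ^ 2 / 2 else 1 / c ^ 2 * omega (c * t * r)) ≤ φ t := by
  have h1 : ∀ t ∈ Icc 0 T, r ^ 2 * t / (1 + c * t * r) ≤ φ' t - φ' 0 := by
    intro t ht
    simpa using sub_le_sub_of_hasDerivWithinAt_le
      (fun t ht ↦ (hasDerivAt_mul_div_one_add c r (hc t ht).ne').hasDerivWithinAt) hφ' hq ht
  refine ⟨h1 t ht, ?_⟩
  have h2 := sub_le_sub_of_hasDerivWithinAt_le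
    (fun t ht ↦ (((hasDerivAt_id t).const_mul (φ' 0)).add
      (hasDerivAt_primitive c r (hc t ht).ne')).hasDerivWithinAt) hφ
    (fun t ht ↦ by linarith [h1 t ht]) ht
  simp [omega] at h2 ⊢
  linarith

theorem upper_bounds {φ φ' q : ℝ → ℝ} {c r T : ℝ}
    (hφ : ∀ t ∈ Icc 0 T, HasDerivWithinAt φ (φ' t) (Icc 0 T) t)
    (hφ' : ∀ t ∈ Icc 0 T, HasDerivWithinAt φ' (q t) (Icc 0 T) t)
    (hc : ∀ t ∈ Icc 0 T, 0 < 1 + c * t * r)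
    (hq : ∀ t ∈ Icc 0 T, q t ≤ (r / (1 + c * t * r)) ^ 2) {t : ℝ} (ht : t ∈ Icc 0 T) :
    φ' t - φ' 0 ≤ r ^ 2 * t / (1 + c * t * r) ∧
    φ t ≤ φ 0 + φ' 0 * t +
      (if c = 0 then r ^ 2 * t ^ 2 / 2 else 1 / c ^ 2 * omega (c * t * r)) := by
  have h1 : ∀ t ∈ Icc 0 T, φ' t - φ' 0 ≤ r ^ 2 * t / (1 + c * t * r) := by
    intro t ht
    simpa using sub_le_sub_of_hasDerivWithinAt_le hφ'
      (fun t ht ↦ (hasDerivAt_mul_div_one_add c r (hc t ht).ne').hasDerivWithinAt) hq ht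
  refine ⟨h1 t ht, ?_⟩
  have h2 := sub_le_sub_of_hasDerivWithinAt_le hφ
    (fun t ht ↦ (((hasDerivAt_id t).const_mul (φ' 0)).add
      (hasDerivAt_primitive c r (hc t ht).ne')).hasDerivWithinAt)
    (fun t ht ↦ by linarith [h1 t ht]) ht
  simp [omega] at h2 ⊢
  linarith

/-! ### Smoothness of differentials, covariant derivatives and Hessians -/

section Smoothness

variable {E : Type*} [NormedAddCommGroup E] [NormedSpace ℝ E]
  {M : Type*} [TopologicalSpace M] [ChartedSpace E M] [IsManifold 𝓘(ℝ, E) ∞ M]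
  {f : M → ℝ} {x : M} {X Y : ∀ y : M, TangentSpace 𝓘(ℝ, E) y}

theorem contMDiffAt_mvfderiv_apply (hf : ContMDiffAt 𝓘(ℝ, E) 𝓘(ℝ, ℝ) ∞ f x)
    (hY : CMDiffAt ∞ (T% Y) x) :
    ContMDiffAt 𝓘(ℝ, E) 𝓘(ℝ, ℝ) ∞ (fun y ↦ mvfderiv 𝓘(ℝ, E) f y (Y y)) x := by
  have h1 := hf.mfderiv_const (m := ∞) le_rfl
  have h2 := ContMDiffAt.clm_apply_of_inCoordinates (b₁ := id) (b₂ := f)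
    (ϕ := fun y ↦ mfderiv 𝓘(ℝ, E) 𝓘(ℝ, ℝ) f y) h1 hY hf
  exact (contMDiff_snd_tangentBundle_modelSpace ℝ 𝓘(ℝ, ℝ)).contMDiffAt.comp x h2

/-- Tensoriality is tested on fields that are merely differentiable at `x`, so the smooth version is
not enough. -/
theorem mdifferentiableAt_mvfderiv_apply (hf : ContMDiffAt 𝓘(ℝ, E) 𝓘(ℝ, ℝ) ∞ f x)
    (hY : MDiffAt (T% Y) x) :
    MDifferentiableAt 𝓘(ℝ, E) 𝓘(ℝ, ℝ) (fun y ↦ mvfderiv 𝓘(ℝ, E) f y (Y y)) x := by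
  have h1 := (hf.mfderiv_const (m := 1) (by norm_cast)).mdifferentiableAt one_ne_zero
  have h2 := MDifferentiableAt.clm_apply_of_inCoordinates (b₁ := id) (b₂ := f)
    (ϕ := fun y ↦ mfderiv 𝓘(ℝ, E) 𝓘(ℝ, ℝ) f y) h1 hY (hf.mdifferentiableAt (by norm_num))
  exact ((contMDiff_snd_tangentBundle_modelSpace ℝ 𝓘(ℝ, ℝ) (n := 1)).mdifferentiableAt
    one_ne_zero).comp x h2

/-- Replacing `Y` by `gY` adds `u(g) Df(Y)` to both terms, and the two contributions cancel. -/
theorem tensorialAt_hessian (cov : Connection E M) (hf : ContMDiffAt 𝓘(ℝ, E) 𝓘(ℝ, ℝ) ∞ f x)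
    (u : TangentSpace 𝓘(ℝ, E) x) :
    TensorialAt 𝓘(ℝ, E) E (fun Y : ∀ y : M, TangentSpace 𝓘(ℝ, E) y ↦
      mvfderiv 𝓘(ℝ, E) (fun y ↦ mvfderiv 𝓘(ℝ, E) f y (Y y)) x u
        - mvfderiv 𝓘(ℝ, E) f x (cov Y x u)) x where
  smul {g Y} hg hY := by
    have e : (fun y ↦ mvfderiv 𝓘(ℝ, E) f y ((g • Y) y)) =
        g * fun y ↦ mvfderiv 𝓘(ℝ, E) f y (Y y) := by
      ext y; simp
    rw [e, mvfderiv_mul hg (mdifferentiableAt_mvfderiv_apply hf hY),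
      cov.isCovariantDerivativeOnUniv.leibniz hY hg]
    simp
    ring
  add {Y Z} hY hZ := by
    have e : (fun y ↦ mvfderiv 𝓘(ℝ, E) f y ((Y + Z) y)) =
        (fun y ↦ mvfderiv 𝓘(ℝ, E) f y (Y y)) + fun y ↦ mvfderiv 𝓘(ℝ, E) f y (Z y) := by
      ext y; simp
    rw [e, mvfderiv_add (mdifferentiableAt_mvfderiv_apply hf hY)
      (mdifferentiableAt_mvfderiv_apply hf hZ), cov.isCovariantDerivativeOnUniv.add hY hZ]
    simp
    ring

variable [FiniteDimensional ℝ E]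

/-- A locally smooth vector field agrees near each point with a globally smooth one. -/
theorem exists_contMDiff_eventuallyEq [T2Space M] {U : Set M} (hU : IsOpen U) (hx : x ∈ U)
    (hY : CMDiff[U] ∞ (T% Y)) :
    ∃ Z : ∀ y : M, TangentSpace 𝓘(ℝ, E) y, CMDiff ∞ (T% Z) ∧ ∀ᶠ y in 𝓝 x, Z y = Y y := by
  obtain ⟨ψ, hψ, hψU⟩ :=
    (SmoothBumpFunction.nhds_basis_tsupport (I := 𝓘(ℝ, E)) x).mem_iff.1 (hU.mem_nhds hx)
  refine ⟨(ψ : M → ℝ) • Y, ContMDiffOn.smul_section_of_tsupport ψ.contMDiff.contMDiffOn hU hψU hY,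
    ?_⟩
  filter_upwards [ψ.eventuallyEq_one] with y hy
  simp [hy]

/-- Smoothness of the connection is applied to a global field; since `∇` is local, a cutoff of `Y`
that agrees with it near `x` may be used instead. -/
theorem contMDiffAt_cov_apply [T2Space M] (cov : Connection E M)
    [CovariantDerivative.ContMDiffCovariantDerivative cov ∞] {U : Set M} (hU : IsOpen U)
    (hx : x ∈ U) (hY : CMDiff[U] ∞ (T% Y)) (hX : CMDiffAt ∞ (T% X) x) :
    CMDiffAt ∞ (T% (fun y ↦ cov Y y (X y))) x := by
  obtain ⟨Z, hZ, hZY⟩ := exists_contMDiff_eventuallyEq hU hx hY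
  have h1 := (CovariantDerivative.ContMDiffCovariantDerivative.contMDiff
    (cov := cov) (k := ∞)).contMDiff (σ := Z) hZ.contMDiffOn
  have h2 : CMDiffAt ∞ (T% (fun y ↦ cov Z y (X y))) x :=
    ContMDiffAt.clm_bundle_apply (b := id) (h1.contMDiffAt Filter.univ_mem) hX
  refine h2.congr_of_eventuallyEq ?_
  filter_upwards [hZY.eventually_nhds, hU.mem_nhds hx] with y hy hyU
  have : cov Y y = cov Z y :=
    cov.isCovariantDerivativeOnUniv.congr_of_eventuallyEq
      ((hY.contMDiffAt (hU.mem_nhds hyU)).mdifferentiableAt (by norm_num))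
      (hZ.contMDiffAt.mdifferentiableAt (by norm_num)) Filter.univ_mem (hy.mono fun _ h ↦ h.symm)
  simp [this]

/-- The Hessian may be computed with any differentiable extension of the second argument. -/
theorem hessian_apply (cov : Connection E M) (hf : ContMDiffAt 𝓘(ℝ, E) 𝓘(ℝ, ℝ) ∞ f x)
    (u : TangentSpace 𝓘(ℝ, E) x) (hY : MDiffAt (T% Y) x) :
    hessian cov f x u (Y x) = mvfderiv 𝓘(ℝ, E) (fun y ↦ mvfderiv 𝓘(ℝ, E) f y (Y y)) x u
        - mvfderiv 𝓘(ℝ, E) f x (cov Y x u) :=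
  (tensorialAt_hessian cov hf u).mkHom_apply hY

/-- Linearity in the first slot is visible in the definition. In the second, the chosen extension
matters, and linearity comes from tensoriality. -/
theorem isBilinearMap_hessian (cov : Connection E M)
    (hf : ContMDiffAt 𝓘(ℝ, E) 𝓘(ℝ, ℝ) ∞ f x) : IsBilinearMap ℝ (hessian cov f x) where
  add_left u v w := by simp [hessian]; ring
  smul_left c u w := by simp [hessian]; ring
  add_right u v w := ((tensorialAt_hessian cov hf u).mkHom _ _).map_add v w
  smul_right c u w := ((tensorialAt_hessian cov hf u).mkHom _ _).map_smul c w

theorem mdifferentiableAt_hessian_apply [T2Space M] (cov : Connection E M)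
    [CovariantDerivative.ContMDiffCovariantDerivative cov ∞] {U : Set M} (hU : IsOpen U)
    (hx : x ∈ U) (hf : ∀ᶠ y in 𝓝 x, ContMDiffAt 𝓘(ℝ, E) 𝓘(ℝ, ℝ) ∞ f y)
    (hX : CMDiff[U] ∞ (T% X)) (hY : CMDiff[U] ∞ (T% Y)) :
    MDifferentiableAt 𝓘(ℝ, E) 𝓘(ℝ, ℝ) (fun y ↦ hessian cov f y (X y) (Y y)) x := by
  have hXx := hX.contMDiffAt (hU.mem_nhds hx)
  have h1 := contMDiffAt_mvfderiv_apply
    (contMDiffAt_mvfderiv_apply hf.self_of_nhds (hY.contMDiffAt (hU.mem_nhds hx))) hXx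
  have h2 := contMDiffAt_mvfderiv_apply hf.self_of_nhds (contMDiffAt_cov_apply cov hU hx hY hXx)
  refine ((h1.sub h2).mdifferentiableAt (by norm_num)).congr_of_eventuallyEq ?_
  filter_upwards [hf, hU.mem_nhds hx] with y hy hyU
  exact hessian_apply cov hy _ ((hY.contMDiffAt (hU.mem_nhds hyU)).mdifferentiableAt (by norm_num))

end Smoothness

/-! ### Differentiation of tensors along a curve -/

section Curve

variable {E : Type*} [NormedAddCommGroup E] [NormedSpace ℝ E]
  {M : Type*} [TopologicalSpace M] [ChartedSpace E M] [IsManifold 𝓘(ℝ, E) ∞ M]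

/-- The vector field with constant coordinates `w` in the chart at `x`. -/
noncomputable def constField (x : M) (w : E) (y : M) : TangentSpace 𝓘(ℝ, E) y :=
  (trivializationAt E (TangentSpace 𝓘(ℝ, E) : M → Type _) x).symm y w

/-- The coordinates of a tangent vector at `y` in the chart at `x`. -/
noncomputable def coords (x y : M) (u : TangentSpace 𝓘(ℝ, E) y) : E :=
  ((trivializationAt E (TangentSpace 𝓘(ℝ, E) : M → Type _) x) ⟨y, u⟩).2

theorem constField_sum {x y : M}
    (hy : y ∈ (trivializationAt E (TangentSpace 𝓘(ℝ, E) : M → Type _) x).baseSet)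
    {ι : Type*} (s : Finset ι) (c : ι → ℝ) (w : ι → E) :
    constField x (∑ i ∈ s, c i • w i) y = ∑ i ∈ s, c i • constField x (w i) y := by
  have h := map_sum ((trivializationAt E (TangentSpace 𝓘(ℝ, E) : M → Type _) x).symmₗ ℝ y)
    (fun i ↦ c i • w i) s
  simp only [map_smul, Trivialization.coe_symmₗ _ hy] at h
  exact h

theorem constField_coords {x y : M}
    (hy : y ∈ (trivializationAt E (TangentSpace 𝓘(ℝ, E) : M → Type _) x).baseSet)
    (u : TangentSpace 𝓘(ℝ, E) y) : constField x (coords x y u) y = u :=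
  (trivializationAt E (TangentSpace 𝓘(ℝ, E) : M → Type _) x).symm_apply_apply_mk hy u

theorem contMDiffOn_constField (x : M) (w : E) :
    CMDiff[(trivializationAt E (TangentSpace 𝓘(ℝ, E) : M → Type _) x).baseSet] ∞
      (T% (constField x w)) := by
  set e := trivializationAt E (TangentSpace 𝓘(ℝ, E) : M → Type _) x with he
  have : CMDiff[e.baseSet] ∞ (fun y ↦ (e ⟨y, constField x w y⟩).2) :=
    (contMDiffOn_const (c := w)).congr fun y hy ↦ by simp [constField, ← he, hy]
  intro y hy
  rw [e.contMDiffWithinAt_section _ hy]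
  exact this y hy

omit [IsManifold 𝓘(ℝ, E) ∞ M] in
theorem hasDerivWithinAt_comp {g : M → ℝ} {γ : ℝ → M} {s : Set ℝ} {t : ℝ}
    (hg : MDifferentiableAt 𝓘(ℝ, E) 𝓘(ℝ, ℝ) g (γ t))
    (hγ : MDifferentiableWithinAt 𝓘(ℝ, ℝ) 𝓘(ℝ, E) γ s t) :
    HasDerivWithinAt (g ∘ γ) (mvfderiv 𝓘(ℝ, E) g (γ t) (velocity γ s t)) s t := by
  have h := HasMFDerivAt.comp_hasMFDerivWithinAt t hg.hasMFDerivAt hγ.hasMFDerivWithinAt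
  have h' : HasFDerivWithinAt (g ∘ γ)
      ((mvfderiv 𝓘(ℝ, E) g (γ t)).comp (mfderivWithin 𝓘(ℝ, ℝ) 𝓘(ℝ, E) γ s t) : ℝ →L[ℝ] ℝ) s t :=
    hasMFDerivWithinAt_iff_hasFDerivWithinAt.1 h
  exact h'.hasDerivWithinAt

/-- The velocity is the tangent map of `γ` composed with the smooth section `τ ↦ (τ, 1)`. -/
theorem contDiffWithinAt_coords_velocity {γ : ℝ → M} {s : Set ℝ} {t : ℝ} (hs : UniqueDiffOn ℝ s)
    (hts : t ∈ s) (hγ : ContMDiffOn 𝓘(ℝ, ℝ) 𝓘(ℝ, E) ∞ γ s) :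
    ContDiffWithinAt ℝ ∞ (fun τ ↦ coords (E := E) (γ t) (γ τ) (velocity γ s τ)) s t := by
  have h1 := hγ.contMDiffOn_tangentMapWithin (m := ∞) le_rfl hs.uniqueMDiffOn
  have h2 : ContMDiff 𝓘(ℝ, ℝ) 𝓘(ℝ, ℝ).tangent ∞
      (fun τ : ℝ ↦ (⟨τ, (1 : ℝ)⟩ : TangentBundle 𝓘(ℝ, ℝ) ℝ)) :=
    contMDiff_vectorSpace_iff_contDiff.2 contDiff_const
  have h3 := (h1.comp h2.contMDiffOn (fun τ hτ ↦ hτ)) t hts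
  exact (contMDiffWithinAt_totalSpace.1 h3).2.contDiffWithinAt

variable {cov : Connection E M} {γ : ℝ → M} {s : Set ℝ} {t : ℝ}

/-- The geodesic equation in the chart at `γ t`: coordinate acceleration equals minus the
Christoffel term. -/
theorem constField_derivWithin_coords (hγ : IsGeodesicOn cov γ s) (hts : t ∈ s) :
    constField (γ t) (derivWithin (fun τ ↦ coords (E := E) (γ t) (γ τ) (velocity γ s τ)) s t) (γ t)
      = -cov (FiberBundle.extend E (velocity γ s t)) (γ t) (velocity γ s t) :=
  eq_neg_of_add_eq_zero_left (hγ.parallel t hts)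

variable [FiniteDimensional ℝ E]

omit [FiniteDimensional ℝ E] in
theorem eventually_mem_baseSet (hγ : ContinuousWithinAt γ s t) : ∀ᶠ τ in 𝓝[s] t,
    γ τ ∈ (trivializationAt E (TangentSpace 𝓘(ℝ, E) : M → Type _) (γ t)).baseSet :=
  hγ ((trivializationAt E (TangentSpace 𝓘(ℝ, E) : M → Type _) (γ t)).open_baseSet.mem_nhds
    (FiberBundle.mem_baseSet_trivializationAt' (γ t)))

/-- Near `t`, the velocity has the expansion `∑ i, vⁱ eᵢ` in the coordinate frame at `γ t`. -/
theorem eventually_velocity_eq_sum (hγ : ContinuousWithinAt γ s t) :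
    ∀ᶠ τ in 𝓝[s] t, velocity γ s τ =
      ∑ i, (Module.finBasis ℝ E).repr (coords (E := E) (γ t) (γ τ) (velocity γ s τ)) i •
        constField (γ t) (Module.finBasis ℝ E i) (γ τ) := by
  filter_upwards [eventually_mem_baseSet (E := E) hγ] with τ hτ
  rw [← constField_sum hτ, Module.Basis.sum_repr, constField_coords hτ]

theorem constField_eq_sum {x y : M}
    (hy : y ∈ (trivializationAt E (TangentSpace 𝓘(ℝ, E) : M → Type _) x).baseSet) (w : E) :
    constField x w y = ∑ i, (Module.finBasis ℝ E).repr w i •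
      constField x (Module.finBasis ℝ E i) y := by
  rw [← constField_sum hy, Module.Basis.sum_repr]

theorem hasDerivWithinAt_repr_coords (hs : UniqueDiffOn ℝ s)
    (hts : t ∈ s) (hγ : ContMDiffOn 𝓘(ℝ, ℝ) 𝓘(ℝ, E) ∞ γ s) (i) :
    HasDerivWithinAt (fun τ ↦
      (Module.finBasis ℝ E).repr (coords (E := E) (γ t) (γ τ) (velocity γ s τ)) i)
      ((Module.finBasis ℝ E).repr
        (derivWithin (fun τ ↦ coords (E := E) (γ t) (γ τ) (velocity γ s τ)) s t) i) s t := by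
  have h := ((contDiffWithinAt_coords_velocity hs hts hγ).differentiableWithinAt
    (by norm_num)).hasDerivWithinAt
  exact ((Module.finBasis ℝ E).coord i).toContinuousLinearMap.hasFDerivAt.comp_hasDerivWithinAt t h

/-- `d/dt α(γ̇) = (∇_γ̇ α)(γ̇)` for a one-form `α` along a geodesic `γ`. -/
theorem IsGeodesicOn.hasDerivWithinAt_oneForm (hγ : IsGeodesicOn cov γ s) (hs : UniqueDiffOn ℝ s)
    (hts : t ∈ s) {α : ∀ y : M, TangentSpace 𝓘(ℝ, E) y → ℝ}
    (hlin : ∀ᶠ y in 𝓝 (γ t), IsLinearMap ℝ (α y))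
    (hdiff : ∀ w, MDifferentiableAt 𝓘(ℝ, E) 𝓘(ℝ, ℝ)
      (fun y ↦ α y (constField (γ t) w y)) (γ t)) :
    HasDerivWithinAt (fun τ ↦ α (γ τ) (velocity γ s τ))
      (mvfderiv 𝓘(ℝ, E) (fun y ↦ α y (FiberBundle.extend E (velocity γ s t) y)) (γ t)
          (velocity γ s t)
        - α (γ t) (cov (FiberBundle.extend E (velocity γ s t)) (γ t) (velocity γ s t))) s t := by
  have hγt := hγ.smooth t hts
  have hx := FiberBundle.mem_baseSet_trivializationAt' (F := E)
    (E := (TangentSpace 𝓘(ℝ, E) : M → Type _)) (γ t)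
  have hmd := hγt.mdifferentiableWithinAt (by norm_num)
  have hsum : ∀ {y : M} (_ : IsLinearMap ℝ (α y)) {ι : Type} (S : Finset ι) (c : ι → ℝ)
      (w : ι → TangentSpace 𝓘(ℝ, E) y), α y (∑ i ∈ S, c i • w i) = ∑ i ∈ S, c i * α y (w i) := by
    intro y hy ι S c w
    have h := map_sum hy.mk' (fun i ↦ c i • w i) S
    simp only [map_smul, IsLinearMap.mk'_apply, smul_eq_mul] at h
    exact h
  have hcomp := fun w ↦ hasDerivWithinAt_comp (E := E) (hdiff w) hmd
  have hv := hasDerivWithinAt_repr_coords hs hts hγ.smooth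
  set u := velocity (E := E) γ s t
  set v : Fin _ → ℝ → ℝ := fun i τ ↦
    (Module.finBasis ℝ E).repr (coords (E := E) (γ t) (γ τ) (velocity γ s τ)) i
  set w := derivWithin (fun τ ↦ coords (E := E) (γ t) (γ τ) (velocity γ s τ)) s t
  have hlin' := hγt.continuousWithinAt.eventually hlin
  -- Coefficients frozen at time `t`: both sides are the derivative along `γ` of the same function,
  -- so they agree by uniqueness of derivatives within `s`.
  have h1 : mvfderiv 𝓘(ℝ, E) (fun y ↦ α y (FiberBundle.extend E u y)) (γ t) u =
      ∑ i, v i t * mvfderiv 𝓘(ℝ, E)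
        (fun y ↦ α y (constField (γ t) (Module.finBasis ℝ E i) y)) (γ t) u := by
    refine (hs t hts).eq_deriv _ (hcomp (coords (γ t) (γ t) u))
      ((HasDerivWithinAt.fun_sum fun i _ ↦
        (hcomp (Module.finBasis ℝ E i)).const_mul (v i t)).congr_of_eventuallyEq_of_mem ?_ hts)
    filter_upwards [hlin', eventually_mem_baseSet (E := E) hγt.continuousWithinAt] with τ hτ hτb
    simp only [Function.comp]
    rw [constField_eq_sum hτb, hsum hτ]
  have h2 : α (γ t) (cov (FiberBundle.extend E u) (γ t) u) =
      -∑ i, (Module.finBasis ℝ E).repr w i *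
        α (γ t) (constField (γ t) (Module.finBasis ℝ E i) (γ t)) := by
    rw [← hsum hlin.self_of_nhds, ← constField_eq_sum hx, constField_derivWithin_coords hγ hts,
      hlin.self_of_nhds.map_neg, neg_neg]
  -- Product rule with the moving coefficients. Differentiating the frame gives `h1`;
  -- differentiating the coefficients gives the connection term `h2`.
  have h3 := HasDerivWithinAt.fun_sum (u := Finset.univ)
    fun i _ ↦ (hv i).mul (hcomp (Module.finBasis ℝ E i))
  refine (h3.congr_of_eventuallyEq_of_mem ?_ hts).congr_deriv ?_
  · filter_upwards [hlin', eventually_velocity_eq_sum (E := E) hγt.continuousWithinAt] with τ hτ hτ'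
    conv_lhs => rw [hτ']
    rw [hsum hτ]
    rfl
  · rw [h1, h2, sub_neg_eq_add, Finset.sum_add_distrib, add_comm]
    rfl

/-- `d/dt G(γ̇, γ̇) = (∇_γ̇ G)(γ̇, γ̇)` for a `(0,2)`-tensor field `G` along a geodesic `γ`. -/
theorem IsGeodesicOn.hasDerivWithinAt_tensor (hγ : IsGeodesicOn cov γ s) (hs : UniqueDiffOn ℝ s)
    (hts : t ∈ s) {G : ∀ y : M, TangentSpace 𝓘(ℝ, E) y → TangentSpace 𝓘(ℝ, E) y → ℝ}
    (hlin : ∀ᶠ y in 𝓝 (γ t), IsBilinearMap ℝ (G y))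
    (hdiff : ∀ w w', MDifferentiableAt 𝓘(ℝ, E) 𝓘(ℝ, ℝ)
      (fun y ↦ G y (constField (γ t) w y) (constField (γ t) w' y)) (γ t)) :
    HasDerivWithinAt (fun τ ↦ G (γ τ) (velocity γ s τ) (velocity γ s τ))
      (covDerivTensor cov G (γ t) (velocity γ s t) (velocity γ s t) (velocity γ s t)) s t := by
  have hγt := hγ.smooth t hts
  have hx := FiberBundle.mem_baseSet_trivializationAt' (F := E)
    (E := (TangentSpace 𝓘(ℝ, E) : M → Type _)) (γ t)
  have hmd := hγt.mdifferentiableWithinAt (by norm_num)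
  have hsum : ∀ {y : M} (_ : IsBilinearMap ℝ (G y)) {ι : Type} (S : Finset ι) (c d : ι → ℝ)
      (w : ι → TangentSpace 𝓘(ℝ, E) y), G y (∑ i ∈ S, c i • w i) (∑ i ∈ S, d i • w i) =
        ∑ i ∈ S, ∑ j ∈ S, c i * d j * G y (w i) (w j) := by
    intro y hy ι S c d w
    have h := LinearMap.map_sum₂ hy.toLinearMap S (fun i ↦ c i • w i) (∑ i ∈ S, d i • w i)
    refine h.trans (Finset.sum_congr rfl fun i _ ↦ ?_)
    simp only [map_sum, map_smul, LinearMap.smul_apply, smul_eq_mul]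
    exact Finset.sum_congr rfl fun j _ ↦ by
      rw [mul_left_comm, ← mul_assoc]
      rfl
  have hcomp := fun w w' ↦ hasDerivWithinAt_comp (E := E) (hdiff w w') hmd
  have hv := hasDerivWithinAt_repr_coords hs hts hγ.smooth
  have hut : velocity (E := E) γ s t = constField (γ t) (coords (γ t) (γ t) (velocity γ s t)) (γ t) :=
    (constField_coords (FiberBundle.mem_baseSet_trivializationAt' (γ t)) _).symm
  unfold covDerivTensor
  set u := velocity (E := E) γ s t
  set v : Fin _ → ℝ → ℝ := fun i τ ↦
    (Module.finBasis ℝ E).repr (coords (E := E) (γ t) (γ τ) (velocity γ s τ)) i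
  set w := derivWithin (fun τ ↦ coords (E := E) (γ t) (γ τ) (velocity γ s τ)) s t
  have hlin' := hγt.continuousWithinAt.eventually hlin
  have hlint := hlin.self_of_nhds
  have hcov : cov (FiberBundle.extend E u) (γ t) u =
      (-1 : ℝ) • constField (γ t) w (γ t) := by
    rw [constField_derivWithin_coords hγ hts, neg_one_smul, neg_neg]
  have hut' : u = ∑ i, v i t • constField (γ t) (Module.finBasis ℝ E i) (γ t) := by
    conv_lhs => rw [hut, constField_eq_sum hx]
  have h1 : mvfderiv 𝓘(ℝ, E)
      (fun y ↦ G y (FiberBundle.extend E u y) (FiberBundle.extend E u y)) (γ t) u =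
      ∑ i, ∑ j, v i t * v j t * mvfderiv 𝓘(ℝ, E) (fun y ↦
        G y (constField (γ t) (Module.finBasis ℝ E i) y)
          (constField (γ t) (Module.finBasis ℝ E j) y)) (γ t) u := by
    refine (hs t hts).eq_deriv _ (hcomp (coords (γ t) (γ t) u) (coords (γ t) (γ t) u))
      ((HasDerivWithinAt.fun_sum fun i _ ↦ HasDerivWithinAt.fun_sum fun j _ ↦
        (hcomp (Module.finBasis ℝ E i) (Module.finBasis ℝ E j)).const_mul
          (v i t * v j t)).congr_of_eventuallyEq_of_mem ?_ hts)
    filter_upwards [hlin', eventually_mem_baseSet (E := E) hγt.continuousWithinAt] with τ hτ hτb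
    simp only [Function.comp]
    rw [constField_eq_sum hτb, hsum hτ]
  have h2 : G (γ t) (cov (FiberBundle.extend E u) (γ t) u) u =
      -∑ i, ∑ j, (Module.finBasis ℝ E).repr w i * v j t *
        G (γ t) (constField (γ t) (Module.finBasis ℝ E i) (γ t))
          (constField (γ t) (Module.finBasis ℝ E j) (γ t)) := by
    rw [hcov, hlint.smul_left, neg_one_smul, ← hsum hlint, ← constField_eq_sum hx, ← hut']
  have h3 : G (γ t) u (cov (FiberBundle.extend E u) (γ t) u) =
      -∑ i, ∑ j, v i t * (Module.finBasis ℝ E).repr w j *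
        G (γ t) (constField (γ t) (Module.finBasis ℝ E i) (γ t))
          (constField (γ t) (Module.finBasis ℝ E j) (γ t)) := by
    rw [hcov, hlint.smul_right, neg_one_smul, ← hsum hlint, ← hut', ← constField_eq_sum hx]
  -- The product rule has three parts: one for each velocity slot, matching `h2` and `h3`, and one
  -- for the tensor in the frame, matching `h1`.
  have h4 := HasDerivWithinAt.fun_sum (u := Finset.univ)
    fun i _ ↦ HasDerivWithinAt.fun_sum (u := Finset.univ)
    fun j _ ↦ ((hv i).mul (hv j)).mul (hcomp (Module.finBasis ℝ E i) (Module.finBasis ℝ E j))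
  refine (h4.congr_of_eventuallyEq_of_mem ?_ hts).congr_deriv ?_
  · filter_upwards [hlin', eventually_velocity_eq_sum (E := E) hγt.continuousWithinAt] with τ hτ hτ'
    conv_lhs => rw [hτ']
    rw [hsum hτ]
    rfl
  · rw [h1, h2, h3, sub_neg_eq_add, sub_neg_eq_add]
    simp only [add_mul, Finset.sum_add_distrib]
    rw [add_comm, add_assoc]
    rfl

end Curve

/-! ### Self-concordant functions along geodesics -/

section SelfConcordant

variable {E : Type*} [NormedAddCommGroup E] [NormedSpace ℝ E] [FiniteDimensional ℝ E]
  {M : Type*} [TopologicalSpace M] [ChartedSpace E M] [IsManifold 𝓘(ℝ, E) ∞ M]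
  {cov : Connection E M} {C : Set M} {f : M → ℝ} {σ : ℝ} {γ : ℝ → M} {t T : ℝ}

omit [FiniteDimensional ℝ E] in
theorem IsGeodesicOn.hasDerivWithinAt_comp {s : Set ℝ} (hγ : IsGeodesicOn cov γ s) (hts : t ∈ s)
    (hf : ContMDiffAt 𝓘(ℝ, E) 𝓘(ℝ, ℝ) ∞ f (γ t)) :
    HasDerivWithinAt (fun τ ↦ f (γ τ)) (mvfderiv 𝓘(ℝ, E) f (γ t) (velocity γ s t)) s t :=
  AffineManifold.hasDerivWithinAt_comp (hf.mdifferentiableAt (by norm_num))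
    ((hγ.smooth t hts).mdifferentiableWithinAt (by norm_num))

theorem IsGeodesicOn.hasDerivWithinAt_mvfderiv {s : Set ℝ} (hγ : IsGeodesicOn cov γ s)
    (hs : UniqueDiffOn ℝ s) (hts : t ∈ s) (hf : ContMDiffAt 𝓘(ℝ, E) 𝓘(ℝ, ℝ) ∞ f (γ t)) :
    HasDerivWithinAt (fun τ ↦ mvfderiv 𝓘(ℝ, E) f (γ τ) (velocity γ s τ))
      (hessian cov f (γ t) (velocity γ s t) (velocity γ s t)) s t := by
  refine hγ.hasDerivWithinAt_oneForm hs hts (α := fun y u ↦ mvfderiv 𝓘(ℝ, E) f y u)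
    (Filter.Eventually.of_forall fun y ↦ ⟨map_add _, map_smul _⟩) fun w ↦
      mdifferentiableAt_mvfderiv_apply hf ?_
  have hx := FiberBundle.mem_baseSet_trivializationAt' (F := E)
    (E := (TangentSpace 𝓘(ℝ, E) : M → Type _)) (γ t)
  exact ((contMDiffOn_constField (γ t) w).contMDiffAt
    ((trivializationAt E (TangentSpace 𝓘(ℝ, E) : M → Type _) (γ t)).open_baseSet.mem_nhds
      hx)).mdifferentiableAt (by norm_num)

theorem IsGeodesicOn.hasDerivWithinAt_hessian [T2Space M]
    [CovariantDerivative.ContMDiffCovariantDerivative cov ∞] {s : Set ℝ}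
    (hγ : IsGeodesicOn cov γ s) (hs : UniqueDiffOn ℝ s) (hts : t ∈ s)
    (hf : ∀ᶠ y in 𝓝 (γ t), ContMDiffAt 𝓘(ℝ, E) 𝓘(ℝ, ℝ) ∞ f y) :
    HasDerivWithinAt (fun τ ↦ hessian cov f (γ τ) (velocity γ s τ) (velocity γ s τ))
      (covDerivTensor cov (hessian cov f) (γ t) (velocity γ s t) (velocity γ s t)
        (velocity γ s t)) s t :=
  hγ.hasDerivWithinAt_tensor hs hts (hf.mono fun _ ↦ isBilinearMap_hessian cov) fun w w' ↦
    mdifferentiableAt_hessian_apply cov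
      (trivializationAt E (TangentSpace 𝓘(ℝ, E) : M → Type _) (γ t)).open_baseSet
      (FiberBundle.mem_baseSet_trivializationAt' (γ t)) hf
      (contMDiffOn_constField (γ t) w) (contMDiffOn_constField (γ t) w')

namespace IsWeaklySelfConcordant

variable (hf : IsWeaklySelfConcordant cov C f σ) (hC : IsOpen C)
include hf hC

omit [FiniteDimensional ℝ E] in
theorem contMDiffAt {x : M} (hx : x ∈ C) : ContMDiffAt 𝓘(ℝ, E) 𝓘(ℝ, ℝ) ∞ f x :=
  hf.smooth.contMDiffAt (hC.mem_nhds hx)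

theorem hessian_self_nonneg {x : M} (hx : x ∈ C) (u : TangentSpace 𝓘(ℝ, E) x) :
    0 ≤ hessian cov f x u u := by
  rcases eq_or_ne u 0 with rfl | hu
  · have := (isBilinearMap_hessian cov (hf.contMDiffAt hC hx)).smul_left 0 0 0
    simp only [zero_smul] at this
    exact this.ge
  · exact (hf.nondegenerate x hx u hu).le

variable [T2Space M] [CovariantDerivative.ContMDiffCovariantDerivative cov ∞]
  (hγ : IsGeodesicOn cov γ (Icc 0 1)) (hT : T ≤ 1) (hγC : MapsTo γ (Icc 0 T) C)
include hγ hT hγC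

/-- Only `[0, T]` has to be mapped into `C`, while velocities are taken within `[0, 1]`. This lets
the estimates be used before it is known that `γ` stays in `C`. -/
theorem localNorm_bounds (ht : t ∈ Icc 0 T) :
    localNorm cov f (γ 0) (velocity γ (Icc 0 1) 0) ≤
      localNorm cov f (γ t) (velocity γ (Icc 0 1) t) *
        (1 + σ * t * localNorm cov f (γ 0) (velocity γ (Icc 0 1) 0)) ∧
    localNorm cov f (γ t) (velocity γ (Icc 0 1) t) *
        (1 - σ * t * localNorm cov f (γ 0) (velocity γ (Icc 0 1) 0)) ≤
      localNorm cov f (γ 0) (velocity γ (Icc 0 1) 0) := by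
  refine sqrt_le_and_sqrt_mul_le
    (q := fun τ ↦ hessian cov f (γ τ) (velocity γ (Icc 0 1) τ) (velocity γ (Icc 0 1) τ))
    hf.nonneg (fun τ hτ ↦ (hγ.hasDerivWithinAt_hessian (uniqueDiffOn_Icc zero_lt_one)
      ⟨hτ.1, hτ.2.trans hT⟩ ?_).mono (Icc_subset_Icc_right hT))
    (fun τ hτ ↦ hf.hessian_self_nonneg hC (hγC hτ) _) (fun τ hτ ↦ hf.bound _ (hγC hτ) _) ht
  exact Filter.eventually_of_mem (hC.mem_nhds (hγC hτ)) fun y ↦ hf.contMDiffAt hC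

theorem lower_bounds_along {r : ℝ} (hr : r = localNorm cov f (γ 0) (velocity γ (Icc 0 1) 0))
    (ht : t ∈ Icc 0 T) :
    r ^ 2 * t / (1 + σ * t * r) ≤ mvfderiv 𝓘(ℝ, E) f (γ t) (velocity γ (Icc 0 1) t) -
      mvfderiv 𝓘(ℝ, E) f (γ 0) (velocity γ (Icc 0 1) 0) ∧
    f (γ 0) + mvfderiv 𝓘(ℝ, E) f (γ 0) (velocity γ (Icc 0 1) 0) * t +
      (if σ = 0 then r ^ 2 * t ^ 2 / 2 else 1 / σ ^ 2 * omega (σ * t * r)) ≤ f (γ t) := by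
  have hr0 : 0 ≤ r := hr ▸ Real.sqrt_nonneg _
  have hpos : ∀ τ ∈ Icc 0 T, 0 < 1 + σ * τ * r := fun τ hτ ↦ by
    have := mul_nonneg (mul_nonneg hf.nonneg hτ.1) hr0
    linarith
  have hsub : Icc 0 T ⊆ Icc 0 1 := Icc_subset_Icc_right hT
  refine lower_bounds (φ := fun τ ↦ f (γ τ))
    (φ' := fun τ ↦ mvfderiv 𝓘(ℝ, E) f (γ τ) (velocity γ (Icc 0 1) τ))
    (fun τ hτ ↦ (hγ.hasDerivWithinAt_comp (hsub hτ) (hf.contMDiffAt hC (hγC hτ))).mono hsub)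
    (fun τ hτ ↦ (hγ.hasDerivWithinAt_mvfderiv (uniqueDiffOn_Icc zero_lt_one) (hsub hτ)
      (hf.contMDiffAt hC (hγC hτ))).mono hsub) hpos (fun τ hτ ↦ ?_) ht
  have h := (hf.localNorm_bounds hC hγ hT hγC hτ).1
  rw [← hr, ← div_le_iff₀ (hpos τ hτ)] at h
  exact (Real.le_sqrt (div_nonneg hr0 (hpos τ hτ).le)
    (hf.hessian_self_nonneg hC (hγC hτ) _)).1 h

theorem upper_bounds_along {r : ℝ} (hr : r = localNorm cov f (γ 0) (velocity γ (Icc 0 1) 0))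
    (hσr : σ * r < 1) (ht : t ∈ Icc 0 T) :
    mvfderiv 𝓘(ℝ, E) f (γ t) (velocity γ (Icc 0 1) t) -
      mvfderiv 𝓘(ℝ, E) f (γ 0) (velocity γ (Icc 0 1) 0) ≤ r ^ 2 * t / (1 - σ * t * r) ∧
    f (γ t) ≤ f (γ 0) + mvfderiv 𝓘(ℝ, E) f (γ 0) (velocity γ (Icc 0 1) 0) * t +
      (if σ = 0 then r ^ 2 * t ^ 2 / 2 else 1 / σ ^ 2 * omegaStar (σ * t * r)) := by
  have hr0 : 0 ≤ r := hr ▸ Real.sqrt_nonneg _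
  have hpos : ∀ τ ∈ Icc 0 T, 0 < 1 + -σ * τ * r := fun τ hτ ↦ by
    have := mul_le_mul_of_nonneg_left (hτ.2.trans hT) (mul_nonneg hf.nonneg hr0)
    linarith
  have hsub : Icc 0 T ⊆ Icc 0 1 := Icc_subset_Icc_right hT
  have key := upper_bounds (φ := fun τ ↦ f (γ τ)) (c := -σ) (r := r)
    (φ' := fun τ ↦ mvfderiv 𝓘(ℝ, E) f (γ τ) (velocity γ (Icc 0 1) τ))
    (fun τ hτ ↦ (hγ.hasDerivWithinAt_comp (hsub hτ) (hf.contMDiffAt hC (hγC hτ))).mono hsub)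
    (fun τ hτ ↦ (hγ.hasDerivWithinAt_mvfderiv (uniqueDiffOn_Icc zero_lt_one) (hsub hτ)
      (hf.contMDiffAt hC (hγC hτ))).mono hsub) hpos (fun τ hτ ↦ ?_) ht
  -- With `c = -σ`, the identity `ω(-s) = ω*(s)` turns one primitive into the other.
  · simpa [omega, omegaStar, ← sub_eq_add_neg] using key
  have h := (hf.localNorm_bounds hC hγ hT hγC hτ).2
  have hp := hpos τ hτ
  rw [← hr, show 1 - σ * τ * r = 1 + -σ * τ * r by ring, ← le_div_iff₀ hp] at h
  exact (Real.sqrt_le_left (by positivity)).1 h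

/-- `f` is bounded along a geodesic of initial length less than `1 / σ`, uniformly in `T ≤ 1`. -/
theorem le_of_localNorm_lt {r : ℝ} (hr : r = localNorm cov f (γ 0) (velocity γ (Icc 0 1) 0))
    (hσr : σ * r < 1) (ht : t ∈ Icc 0 T) :
    f (γ t) ≤ f (γ 0) +
      |mvfderiv 𝓘(ℝ, E) f (γ 0) (velocity γ (Icc 0 1) 0) + r ^ 2 / (1 - σ * r)| := by
  have hr0 : 0 ≤ r := hr ▸ Real.sqrt_nonneg _
  have hsub : Icc 0 T ⊆ Icc 0 1 := Icc_subset_Icc_right hT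
  set D := mvfderiv 𝓘(ℝ, E) f (γ 0) (velocity γ (Icc 0 1) 0) + r ^ 2 / (1 - σ * r) with hD
  have h := sub_le_sub_of_hasDerivWithinAt_le (G := fun τ ↦ D * τ) (G' := fun _ ↦ D)
    (fun τ hτ ↦ (hγ.hasDerivWithinAt_comp (hsub hτ) (hf.contMDiffAt hC (hγC hτ))).mono hsub)
    (fun τ _ ↦ by simpa using ((hasDerivAt_id τ).const_mul D).hasDerivWithinAt)
    (fun τ hτ ↦ ?_) ht
  · have h1 : D * t ≤ |D| * 1 := mul_le_mul (le_abs_self D) (ht.2.trans hT) ht.1 (abs_nonneg D)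
    linarith
  · have h1 := (hf.upper_bounds_along hC hγ hT hγC hr hσr hτ).1
    -- The bound on `φ'` increases with `τ`, so its value at `τ = 1` gives a constant slope `D`
    -- independent of `T`.
    have h2 : r ^ 2 * τ / (1 - σ * τ * r) ≤ r ^ 2 / (1 - σ * r) := by
      have hτ1 := hτ.2.trans hT
      have h3 := mul_le_mul_of_nonneg_left hτ1 (mul_nonneg hf.nonneg hr0)
      exact div_le_div₀ (sq_nonneg r) (mul_le_of_le_one_right (sq_nonneg r) hτ1) (by linarith)
        (by linarith)
    linarith

omit hT hγC in
/-- A geodesic of initial length less than `1 / σ` does not leave the domain. -/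
theorem mapsTo_of_localNorm_lt (h0 : γ 0 ∈ C)
    (hσr : σ * localNorm cov f (γ 0) (velocity γ (Icc 0 1) 0) < 1) :
    MapsTo γ (Icc 0 1) C := by
  by_contra hcon
  obtain ⟨t₁, ht₁, ht₁C⟩ : ∃ t ∈ Icc (0 : ℝ) 1, γ t ∉ C := by
    simpa [MapsTo, and_assoc] using hcon
  set S := Icc (0 : ℝ) 1 ∩ γ ⁻¹' Cᶜ with hS
  have hcont : ContinuousOn γ (Icc 0 1) := hγ.smooth.continuousOn
  have hSc : IsClosed S := hcont.preimage_isClosed_of_isClosed isClosed_Icc hC.isClosed_compl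
  have hSb : BddBelow S := ⟨0, fun t ht ↦ ht.1.1⟩
  -- The first exit time is attained because `C` is open; thus `γ(T) ∉ C`.
  obtain ⟨hT, hTC⟩ : sInf S ∈ S := hSc.csInf_mem ⟨t₁, ht₁, ht₁C⟩ hSb
  set T := sInf S with hTdef
  have hlt : ∀ t ∈ Ico 0 T, γ t ∈ C := by
    intro t ht
    by_contra h
    exact ht.2.not_ge (csInf_le hSb ⟨⟨ht.1, ht.2.le.trans hT.2⟩, h⟩)
  have hT0 : 0 < T := hT.1.lt_of_ne fun h ↦ hTC (h ▸ h0)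
  have hsub : Ico 0 T ⊆ Icc 0 1 := fun t ht ↦ ⟨ht.1, ht.2.le.trans hT.2⟩
  have hne : (𝓝[Ico 0 T] T).NeBot := by
    rw [← mem_closure_iff_nhdsWithin_neBot, closure_Ico hT0.ne]
    exact right_mem_Icc.2 hT0.le
  -- The points `(γ t, K)`, with `K` the uniform bound obtained on each `[0, t]`, lie in the
  -- epigraph for `t < T` and converge to `(γ T, K)`.
  have hmem := hf.closed.mem_of_tendsto (((hcont T hT).mono hsub).prodMk_nhds
    (tendsto_const_nhds (x := f (γ 0) + |mvfderiv 𝓘(ℝ, E) f (γ 0) (velocity γ (Icc 0 1) 0) +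
      localNorm cov f (γ 0) (velocity γ (Icc 0 1) 0) ^ 2 /
        (1 - σ * localNorm cov f (γ 0) (velocity γ (Icc 0 1) 0))|)))
    (Filter.eventually_of_mem self_mem_nhdsWithin fun t ht ↦ ⟨hlt t ht,
      hf.le_of_localNorm_lt hC hγ (hsub ht).2
        (fun τ hτ ↦ hlt τ ⟨hτ.1, hτ.2.trans_lt ht.2⟩) rfl hσr ⟨ht.1, le_rfl⟩⟩)
  exact hTC hmem.1

end IsWeaklySelfConcordant

theorem mul_lt_one_of_ofReal_lt_inv (hσ : 0 ≤ σ) {r : ℝ}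
    (h : ENNReal.ofReal r < (ENNReal.ofReal σ)⁻¹) : σ * r < 1 := by
  rcases hσ.eq_or_lt with rfl | hσ
  · simp
  rw [← ENNReal.ofReal_inv_of_pos hσ, ENNReal.ofReal_lt_ofReal_iff (inv_pos.2 hσ)] at h
  calc σ * r < σ * σ⁻¹ := mul_lt_mul_of_pos_left h hσ
    _ = 1 := mul_inv_cancel₀ hσ.ne'

end SelfConcordant

end AffineManifold

theorem mainTheorem8 (n : ℕ)
    {M : Type*} [TopologicalSpace M] [T2Space M] [ChartedSpace (EuclideanSpace ℝ (Fin n)) M]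
    [IsManifold (𝓡 n) ∞ M]
    -- a smooth torsion-free affine connection with everywhere defined, surjective exponential maps
    (cov : AffineManifold.Connection (EuclideanSpace ℝ (Fin n)) M)
    [CovariantDerivative.ContMDiffCovariantDerivative cov ∞]
    (htorsion : cov.torsion = 0)
    (hexp : AffineManifold.ExpDefinedSurjective cov)
    -- an open convex set and a weakly self-concordant function on it
    (C : Set M) (hCopen : IsOpen C) (hCconvex : AffineManifold.GeodesicallyConvex cov C)
    (f : M → ℝ) (σ : ℝ) (hf : AffineManifold.IsWeaklySelfConcordant cov C f σ) :
    -- the Dikin ellipsoid of radius `1/σ` (with `1/0 = ∞`) lies in the domain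
    (∀ x ∈ C, AffineManifold.dikinEllipsoid cov f x (ENNReal.ofReal σ)⁻¹ ⊆ C) ∧
    ∀ γ : ℝ → M, AffineManifold.IsGeodesicOn cov γ (Icc 0 1) → MapsTo γ (Icc 0 1) C →
      ∀ r₀ r₁ d₀ d₁ : ℝ,
      -- `r₀`, `r₁` are the local norms of the velocity of `γ` at times `0`, `1`
      r₀ = AffineManifold.localNorm cov f (γ 0) (AffineManifold.velocity γ (Icc 0 1) 0) →
      r₁ = AffineManifold.localNorm cov f (γ 1) (AffineManifold.velocity γ (Icc 0 1) 1) →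
      -- `d₀`, `d₁` are the values of `Df` on the velocity of `γ` at times `0`, `1`
      d₀ = mvfderiv (𝓡 n) f (γ 0) (AffineManifold.velocity γ (Icc 0 1) 0) →
      d₁ = mvfderiv (𝓡 n) f (γ 1) (AffineManifold.velocity γ (Icc 0 1) 1) →
      -- lower bounds
      (r₁ ≥ r₀ / (1 + σ * r₀) ∧
        d₁ - d₀ ≥ r₀ ^ 2 / (1 + σ * r₀) ∧
        (0 < σ → f (γ 1) ≥ f (γ 0) + d₀ + 1 / σ ^ 2 * AffineManifold.omega (σ * r₀)) ∧
        (σ = 0 → f (γ 1) ≥ f (γ 0) + d₀ + r₀ ^ 2 / 2)) ∧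
      -- upper bounds, when `r₀ < 1/σ` (with `1/0 = ∞`)
      (σ * r₀ < 1 →
        r₁ ≤ r₀ / (1 - σ * r₀) ∧
        d₁ - d₀ ≤ r₀ ^ 2 / (1 - σ * r₀) ∧
        (0 < σ → f (γ 1) ≤ f (γ 0) + d₀ + 1 / σ ^ 2 * AffineManifold.omegaStar (σ * r₀)) ∧
        (σ = 0 → f (γ 1) ≤ f (γ 0) + d₀ + r₀ ^ 2 / 2)) := by
  refine ⟨?_, ?_⟩
  · rintro x hx y ⟨γ, hγ, rfl, rfl, hlt⟩
    exact hf.mapsTo_of_localNorm_lt hCopen hγ hx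
      (AffineManifold.mul_lt_one_of_ofReal_lt_inv hf.nonneg hlt) ⟨zero_le_one, le_rfl⟩
  · intro γ hγ hγC r₀ r₁ d₀ d₁ hr₀ hr₁ hd₀ hd₁
    have h1 : (1 : ℝ) ∈ Icc (0 : ℝ) 1 := ⟨zero_le_one, le_rfl⟩
    have hnorm := hf.localNorm_bounds hCopen hγ le_rfl hγC h1
    have hr0 : 0 ≤ r₀ := hr₀ ▸ Real.sqrt_nonneg _
    have hσr : 0 ≤ σ * r₀ := mul_nonneg hf.nonneg hr0
    rw [← hr₀, ← hr₁, mul_one] at hnorm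
    refine ⟨?_, fun hlt ↦ ?_⟩
    · have h := hf.lower_bounds_along hCopen hγ le_rfl hγC hr₀ h1
      rw [← hd₀, ← hd₁] at h
      simp only [mul_one, one_pow] at h
      refine ⟨(div_le_iff₀ (by linarith)).2 hnorm.1, h.1, fun hσ ↦ ?_, fun hσ ↦ ?_⟩
      · simpa only [if_neg hσ.ne'] using h.2
      · simpa only [if_pos hσ] using h.2
    · have h := hf.upper_bounds_along hCopen hγ le_rfl hγC hr₀ hlt h1
      rw [← hd₀, ← hd₁] at h
      simp only [mul_one, one_pow] at h
      refine ⟨(le_div_iff₀ (by linarith)).2 hnorm.2, h.1, fun hσ ↦ ?_, fun hσ ↦ ?_⟩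
      · simpa only [if_neg hσ.ne'] using h.2
      · simpa only [if_pos hσ] using h.2
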